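/- Let $k\in\mathbb N$. A graph $G$ is called $k$-simply-connected if its cycle space (the subspace of $\mathbb F_2^{E(G)}$ generated by the edge sets of the cycles of $G$) is generated by a set of cycles each of length at most $k$. For a vertex $v$, let $|B_v(r)|\in\mathbb N\cup\{\infty\}$ be the number of vertices at graph distance at most $r$ from $v$; if $G$ is vertex-transitive, this does not depend on $v$. We say that $G$ has superlinear growth if there is no constant $C$ with $|B_v(r)|\le Cr$ for all $r\ge 1$ (in particular this holds if $|B_v(r)|/r\to\infty$), and subquadratic growth if there is no $\varepsilon>0$ with $|B_v(r)|\ge \varepsilon r^2$ for all $r\ge 1$ (in particular this holds if $|B_v(r)|/r^2\to 0$). (i) For every $k\in\mathbb N$, there is no (non-empty) $k$-simply-connected vertex-transitive graph that has both superlinear and subquadratic growth. (ii) In particular, no finitely presented group has superlinear but subquadratic growth: for every finitely presented group $\Gamma$ and every finite generating set $S$ of $\Gamma$, the Cayley graph of $\Gamma$ with respect to $S$ does not have both superlinear and subquadratic growth. -/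

import Mathlib

namespace GraphGrowth

universe u

variable {V : Type u}

/-- The element of the edge space `𝔽₂ ^ E(G)` given by the edge set of a closed walk
(used only for cycles). -/
noncomputable def edgeVector (G : SimpleGraph V) {v : V} (p : G.Walk v v) :
    G.edgeSet → ZMod 2 :=
  Set.indicator {e : G.edgeSet | (e : Sym2 V) ∈ p.edges} 1

/-- The cycle space of `G`: the subspace of the edge space generated by the edge sets of cycles. -/
noncomputable def cycleSpace (G : SimpleGraph V) : Submodule (ZMod 2) (G.edgeSet → ZMod 2) :=
  Submodule.span (ZMod 2) {x | ∃ (v : V) (p : G.Walk v v), p.IsCycle ∧ x = edgeVector G p}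

/-- `G` is `k`-simply-connected: its cycle space is generated by a set of cycles each of length
at most `k`. -/
def IsSC (G : SimpleGraph V) (k : ℕ) : Prop :=
  ∃ S : Set (G.edgeSet → ZMod 2),
    (∀ x ∈ S, ∃ (v : V) (p : G.Walk v v), p.IsCycle ∧ p.length ≤ k ∧ x = edgeVector G p) ∧
    Submodule.span (ZMod 2) S = cycleSpace G

/-- Any vertex can be moved to any other one by an automorphism. -/
def IsVertexTransitive (G : SimpleGraph V) : Prop :=
  ∀ v w : V, ∃ φ : G ≃g G, φ v = w

/-- The closed ball of radius `r` around `v` in the graph distance (Mathlib's `SimpleGraph.ball` is the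
open ball). -/
def closedBall (G : SimpleGraph V) (v : V) (r : ℕ) : Set V :=
  {w | G.edist v w ≤ r}

/-- The growth function at `v`: the number of vertices in the ball of radius `r`
(`⊤` if that ball is infinite). -/
noncomputable def growth (G : SimpleGraph V) (v : V) (r : ℕ) : ℕ∞ :=
  (closedBall G v r).encard

/-- `b` grows superlinearly: it is not bounded by any linear function of the radius `r ≥ 1`.
This holds in particular if `b r / r → ∞`. -/
def IsSuperlinear (b : ℕ → ℕ∞) : Prop :=
  ∀ C : ℕ, ∃ r : ℕ, 1 ≤ r ∧ (C : ℕ∞) * r < b r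

/-- `b` grows subquadratically: there is no `ε > 0` with `b r ≥ ε * r ^ 2` for all `r ≥ 1`
(here `ε = 1 / C`). This holds in particular if `b r / r ^ 2 → 0`. -/
def IsSubquadratic (b : ℕ → ℕ∞) : Prop :=
  ∀ C : ℕ, ∃ r : ℕ, 1 ≤ r ∧ (C : ℕ∞) * b r < (r : ℕ∞) ^ 2

end GraphGrowth

namespace GraphGrowth

universe u

variable {V : Type u}

/-! Subquadratic growth gives a radius `n` whose sphere satisfies `k * |S_n| < 2 * n`; otherwise
summing over the spheres gives a quadratic lower bound (`exists_small_sphere`). Such a ball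
separates the ends of every geodesic of length more than `2 * n` centred at its centre
(`not_joined_of_small_sphere`). Indeed, if the ends lay in one component `K` of the complement, both
points of the geodesic at distance `n` from the centre would lie in the outer vertex boundary of
`K`. That boundary lies in `S_n`. A cut with connected sides in a graph whose cycle space is
generated by cycles of length at most `k` is coarsely connected at scale `k`
(`exists_edist_le_of_isSC`), so those points would be at distance at most `k * |S_n|`; but their
distance is `2 * n`.

By transitivity, every ball of radius `n` thus leaves at least two infinite components, and there is
a dichotomy. If some ball leaves three, so does every ball of that radius, and a branching argument
gives exponential growth (`two_pow_le_ncard`), which is not subquadratic. If no ball does, then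
every vertex of a ball around `o` is within `n` of a long geodesic through `o`: a vertex farther
away would have an infinite component behind it that misses both ends of the geodesic. This gives
linear growth (`ncard_closedBall_le`).

For groups, finite presentability passes to any finite generating set, and the lengths of finitely
many relators bound the cycles needed to generate the cycle space (`exists_isSC_mulCayley`). -/

theorem mem_closedBall {G : SimpleGraph V} {v w : V} {r : ℕ} :
    w ∈ closedBall G v r ↔ G.edist v w ≤ r := Iff.rfl

theorem closedBall_mono (G : SimpleGraph V) (v : V) {r s : ℕ} (h : r ≤ s) :
    closedBall G v r ⊆ closedBall G v s :=
  fun _ hw => le_trans (mem_closedBall.1 hw) (by exact_mod_cast h)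

theorem mem_closedBall_self (G : SimpleGraph V) (v : V) (r : ℕ) : v ∈ closedBall G v r := by
  simp [mem_closedBall]

theorem closedBall_subset_closedBall {G : SimpleGraph V} {v w : V} {r s : ℕ}
    (h : w ∈ closedBall G v s) : closedBall G w r ⊆ closedBall G v (s + r) := by
  intro x hx
  rw [mem_closedBall] at *
  push_cast
  exact G.edist_triangle.trans (add_le_add h hx)

/-! ### Connectivity in the complement of a vertex set. -/

/-- `u` and `v` are joined by a walk that avoids the vertex set `A`. -/
def Joined (G : SimpleGraph V) (A : Set V) (u v : V) : Prop :=
  ∃ p : G.Walk u v, ∀ x ∈ p.support, x ∉ A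

/-- The vertex set of the component of `u` in the complement of `A`. -/
def component (G : SimpleGraph V) (A : Set V) (u : V) : Set V := {v | Joined G A u v}

namespace Joined

variable {G : SimpleGraph V} {A B : Set V} {u v w : V}

theorem refl (h : u ∉ A) : Joined G A u u := ⟨.nil, by simpa using h⟩

theorem symm (h : Joined G A u v) : Joined G A v u := by
  obtain ⟨p, hp⟩ := h
  exact ⟨p.reverse, by simpa using hp⟩

theorem trans (h : Joined G A u v) (h' : Joined G A v w) : Joined G A u w := by
  obtain ⟨p, hp⟩ := h
  obtain ⟨q, hq⟩ := h'
  refine ⟨p.append q, fun x hx => ?_⟩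
  rw [SimpleGraph.Walk.mem_support_append_iff] at hx
  exact hx.elim (hp x) (hq x)

theorem mono (hAB : A ⊆ B) (h : Joined G B u v) : Joined G A u v := by
  obtain ⟨p, hp⟩ := h
  exact ⟨p, fun x hx hA => hp x hx (hAB hA)⟩

theorem left_notMem (h : Joined G A u v) : u ∉ A := by
  obtain ⟨p, hp⟩ := h
  exact hp u p.start_mem_support

theorem right_notMem (h : Joined G A u v) : v ∉ A := h.symm.left_notMem

theorem of_adj (h : G.Adj u v) (hu : u ∉ A) (hv : v ∉ A) : Joined G A u v :=
  ⟨h.toWalk, by simp [hu, hv]⟩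

theorem edist_ne_top (h : Joined G A u v) : G.edist u v ≠ ⊤ := by
  obtain ⟨p, -⟩ := h
  exact SimpleGraph.edist_ne_top_iff_reachable.2 p.reachable

/-- A walk avoiding `A` stays in a component of the complement of `A`, hence avoids any set `B`
disjoint from that component. -/
theorem of_disjoint (h : Joined G A u v) (hB : ∀ x, Joined G A u x → x ∉ B) : Joined G B u v := by
  classical
  obtain ⟨p, hp⟩ := h
  refine ⟨p, fun x hx => hB x ⟨p.takeUntil x hx, fun y hy => hp y ?_⟩⟩
  exact p.support_takeUntil_subset_support hx hy

theorem map {W : Type*} {H : SimpleGraph W} (φ : G ≃g H) {A' : Set W}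
    (hA : ∀ x, φ x ∈ A' → x ∈ A) (h : Joined G A u v) : Joined H A' (φ u) (φ v) := by
  obtain ⟨p, hp⟩ := h
  refine ⟨p.map φ.toHom, fun x hx hx' => ?_⟩
  rw [SimpleGraph.Walk.support_map, List.mem_map] at hx
  obtain ⟨y, hy, rfl⟩ := hx
  exact hp y hy (hA y hx')

end Joined

/-! ### Geodesics and balls. -/

/-- `γ` restricted to `{0, …, L}` is an isometric path. -/
def IsGeodesic (G : SimpleGraph V) (γ : ℕ → V) (L : ℕ) : Prop :=
  ∀ i j, i ≤ j → j ≤ L → G.edist (γ i) (γ j) = ((j - i : ℕ) : ℕ∞)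

theorem exists_isGeodesic {G : SimpleGraph V} {x w : V} (h : G.edist x w ≠ ⊤) :
    ∃ (γ : ℕ → V) (L : ℕ), γ 0 = x ∧ γ L = w ∧ IsGeodesic G γ L := by
  obtain ⟨L, hL⟩ := ENat.ne_top_iff_exists.1 h
  obtain ⟨p, hp⟩ := SimpleGraph.exists_walk_of_edist_eq_coe hL.symm
  have hle : ∀ i d, i + d ≤ L → G.edist (p.getVert i) (p.getVert (i + d)) ≤ d := by
    intro i d
    induction d with
    | zero => simp
    | succ d ih =>
      intro hd
      have hadj : G.Adj (p.getVert (i + d)) (p.getVert (i + d + 1)) :=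
        p.adj_getVert_succ (by omega)
      refine (G.edist_triangle (v := p.getVert (i + d))).trans ?_
      push_cast
      exact add_le_add (ih (by omega)) (SimpleGraph.edist_eq_one_iff_adj.2 hadj).le
  refine ⟨p.getVert, L, by simp, by simp [← hp], fun i j hij hj => ?_⟩
  have h1 := hle 0 i (by omega)
  have h2 := hle i (j - i) (by omega)
  have h3 := hle j (L - j) (by omega)
  rw [show i + (j - i) = j by omega] at h2
  rw [show j + (L - j) = L by omega] at h3
  rw [Nat.zero_add] at h1
  -- The upper bounds for the three pieces add up to the total distance `L`, so the middle one is
  -- attained.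
  have h0 : (L : ℕ∞) ≤ i + G.edist (p.getVert i) (p.getVert j) + (L - j : ℕ) := by
    have e : G.edist (p.getVert 0) (p.getVert L) = L := by rw [hL]; simp [← hp]
    rw [← e]
    exact G.edist_triangle.trans (add_le_add (G.edist_triangle.trans (add_le_add h1 le_rfl)) h3)
  obtain ⟨d, hd⟩ := ENat.ne_top_iff_exists.1 (ne_top_of_le_ne_top (ENat.natCast_ne_top _) h2)
  rw [← hd] at h0 h2 ⊢
  norm_cast at *
  omega

namespace IsGeodesic

variable {G : SimpleGraph V} {γ : ℕ → V} {L : ℕ}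

theorem adj (h : IsGeodesic G γ L) {i : ℕ} (hi : i + 1 ≤ L) : G.Adj (γ i) (γ (i + 1)) := by
  rw [← SimpleGraph.edist_eq_one_iff_adj, h i (i + 1) (by omega) hi]
  simp

theorem joined (h : IsGeodesic G γ L) {A : Set V} {i j : ℕ} (hij : i ≤ j) (hj : j ≤ L)
    (hA : ∀ t, i ≤ t → t ≤ j → γ t ∉ A) : Joined G A (γ i) (γ j) := by
  induction j, hij using Nat.le_induction with
  | base => exact .refl (hA i le_rfl le_rfl)
  | succ j hij ih =>
    refine (ih (by omega) fun t h1 h2 => hA t h1 (by omega)).trans ?_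
    exact .of_adj (h.adj hj) (hA j hij (by omega)) (hA (j + 1) (by omega) le_rfl)

end IsGeodesic

theorem edist_iso {G : SimpleGraph V} (φ : G ≃g G) (u v : V) :
    G.edist (φ u) (φ v) = G.edist u v := by
  have key : ∀ (φ : G ≃g G) (u v : V), G.edist (φ u) (φ v) ≤ G.edist u v := by
    intro φ u v
    by_cases h : G.edist u v = ⊤
    · simp [h]
    · obtain ⟨p, hp⟩ := SimpleGraph.exists_walk_of_edist_ne_top h
      rw [← hp]
      simpa using SimpleGraph.edist_le (p.map φ.toHom)
  refine le_antisymm (key φ u v) ?_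
  simpa using key φ.symm (φ u) (φ v)

theorem map_mem_closedBall {G : SimpleGraph V} (φ : G ≃g G) {v w : V} {r : ℕ} :
    φ w ∈ closedBall G (φ v) r ↔ w ∈ closedBall G v r := by
  rw [mem_closedBall, mem_closedBall, edist_iso]

theorem image_closedBall {G : SimpleGraph V} (φ : G ≃g G) (v : V) (r : ℕ) :
    φ '' closedBall G v r = closedBall G (φ v) r := by
  ext w
  constructor
  · rintro ⟨x, hx, rfl⟩
    exact (map_mem_closedBall φ).2 hx
  · intro hw
    exact ⟨φ.symm w, (map_mem_closedBall φ).1 (by simpa using hw), by simp⟩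

/-- A vertex of a closed ball is joined to the centre inside the ball. -/
theorem joined_of_mem_closedBall {G : SimpleGraph V} {A : Set V} {v w : V} {r : ℕ}
    (hw : w ∈ closedBall G v r) (hA : ∀ x ∈ closedBall G v r, x ∉ A) : Joined G A v w := by
  rw [mem_closedBall] at hw
  obtain ⟨γ, L, rfl, rfl, h⟩ := exists_isGeodesic (ne_top_of_le_ne_top (ENat.natCast_ne_top _) hw)
  refine h.joined (Nat.zero_le _) le_rfl fun t _ ht => hA _ ?_
  rw [h 0 L (by omega) le_rfl] at hw
  rw [mem_closedBall, h 0 t (by omega) ht]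
  norm_cast at *
  omega

/-- Every vertex outside a ball can be joined outside the ball to a vertex just outside the ball. -/
theorem exists_joined_near {G : SimpleGraph V} {v w : V} {r s : ℕ} (hw : G.edist v w ≠ ⊤)
    (hrs : r < s) (hs : (s : ℕ∞) ≤ G.edist v w) :
    ∃ y, G.edist v y = s ∧ Joined G (closedBall G v r) y w := by
  obtain ⟨γ, L, rfl, rfl, h⟩ := exists_isGeodesic hw
  rw [h 0 L (by omega) le_rfl] at hs
  have hs' : s ≤ L := by exact_mod_cast hs
  refine ⟨γ s, by rw [h 0 s (by omega) hs']; simp, h.joined hs' le_rfl fun t ht1 ht2 => ?_⟩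
  rw [mem_closedBall, h 0 t (by omega) ht2]
  norm_cast
  omega

/-! ### Walks in the edge space and coarse connectedness of cuts. -/

open Classical in
/-- The element of the edge space that counts modulo 2 how often a walk uses each edge. -/
noncomputable def walkVector (G : SimpleGraph V) :
    {u v : V} → G.Walk u v → (G.edgeSet → ZMod 2)
  | _, _, .nil => 0
  | _, _, .cons h p => Pi.single ⟨s(_, _), G.mem_edgeSet.2 h⟩ 1 + walkVector G p

theorem walkVector_append {G : SimpleGraph V} {u v w : V} (p : G.Walk u v) (q : G.Walk v w) :
    walkVector G (p.append q) = walkVector G p + walkVector G q := by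
  induction p with
  | nil => simp [walkVector]
  | cons h p ih => simp [walkVector, ih, add_assoc]

theorem walkVector_apply_of_notMem {G : SimpleGraph V} {u v : V} (p : G.Walk u v) (e : G.edgeSet)
    (he : (e : Sym2 V) ∉ p.edges) : walkVector G p e = 0 := by
  classical
  induction p with
  | nil => rfl
  | cons h p ih =>
    simp only [SimpleGraph.Walk.edges_cons, List.mem_cons, not_or] at he
    simp only [walkVector, Pi.add_apply, ih he.2, add_zero]
    rw [Pi.single_eq_of_ne]
    exact fun h' => he.1 (congrArg Subtype.val h')

theorem walkVector_apply_of_isTrail {G : SimpleGraph V} {u v : V} {p : G.Walk u v}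
    (hp : p.IsTrail) (e : G.edgeSet) (he : (e : Sym2 V) ∈ p.edges) : walkVector G p e = 1 := by
  classical
  induction p with
  | nil => simp at he
  | @cons a b c h p ih =>
    rw [SimpleGraph.Walk.isTrail_cons] at hp
    by_cases h' : e = ⟨s(a, b), G.mem_edgeSet.2 h⟩
    · subst h'
      simp only [walkVector, Pi.add_apply, Pi.single_eq_same]
      rw [walkVector_apply_of_notMem p _ hp.2, add_zero]
    · simp only [walkVector, Pi.add_apply, Pi.single_eq_of_ne h', zero_add]
      refine ih hp.1 ?_
      rw [SimpleGraph.Walk.edges_cons, List.mem_cons] at he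
      exact he.resolve_left fun h'' => h' (Subtype.ext h'')

/-- A trail uses no edge twice, so counting modulo 2 loses nothing. This allows cycles to be handled
through `walkVector`, which is additive under concatenation. -/
theorem edgeVector_eq_walkVector {G : SimpleGraph V} {v : V} {p : G.Walk v v} (hp : p.IsTrail) :
    edgeVector G p = walkVector G p := by
  classical
  funext e
  by_cases he : (e : Sym2 V) ∈ p.edges
  · rw [walkVector_apply_of_isTrail hp e he]
    exact Set.indicator_of_mem (s := {e : G.edgeSet | (e : Sym2 V) ∈ p.edges}) he 1
  · rw [walkVector_apply_of_notMem p e he]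
    exact Set.indicator_of_notMem (s := {e : G.edgeSet | (e : Sym2 V) ∈ p.edges}) he 1

/-- `e` joins a vertex outside `K` satisfying `P` to a vertex of `K`. -/
def IsCrossing (K : Set V) (P : V → Prop) (e : Sym2 V) : Prop :=
  ∃ u w, e = s(u, w) ∧ u ∉ K ∧ w ∈ K ∧ P u

theorem isCrossing_mk {K : Set V} {P : V → Prop} {a b : V} :
    IsCrossing K P s(a, b) ↔ (a ∉ K ∧ b ∈ K ∧ P a) ∨ (b ∉ K ∧ a ∈ K ∧ P b) := by
  constructor
  · rintro ⟨u, w, h, hu⟩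
    rcases Sym2.eq_iff.1 h with ⟨rfl, rfl⟩ | ⟨rfl, rfl⟩
    · exact .inl hu
    · exact .inr hu
  · rintro (h | h)
    · exact ⟨a, b, rfl, h⟩
    · exact ⟨b, a, Sym2.eq_swap, h⟩

/-- The linear functional summing the coordinates in a finite set of edges. -/
def sumOver {E : Type*} (F : Finset E) : (E → ZMod 2) →ₗ[ZMod 2] ZMod 2 :=
  ∑ e ∈ F, LinearMap.proj e

theorem sumOver_apply {E : Type*} (F : Finset E) (x : E → ZMod 2) :
    sumOver F x = ∑ e ∈ F, x e := by
  simp [sumOver]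

theorem sumOver_single {E : Type*} [DecidableEq E] (F : Finset E) (e : E) :
    sumOver F (Pi.single e 1) = if e ∈ F then 1 else 0 := by
  rw [sumOver_apply]
  simp [Pi.single_apply]

open Classical in
/-- A walk crosses the boundary of `K` an even number of times iff its ends lie on the same side. -/
theorem sumOver_walkVector {G : SimpleGraph V} {K : Set V} {F : Finset G.edgeSet}
    (hF : ∀ e : G.edgeSet, e ∈ F ↔ IsCrossing K (fun _ => True) e) {u v : V} (p : G.Walk u v) :
    sumOver F (walkVector G p) = (if u ∈ K then 1 else 0) + (if v ∈ K then 1 else 0) := by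
  have two : (1 : ZMod 2) + 1 = 0 := by decide
  induction p with
  | @nil a => by_cases h : a ∈ K <;> simp [walkVector, h, two]
  | @cons a b c h p ih =>
    rw [walkVector, map_add, ih, sumOver_single]
    simp only [hF, isCrossing_mk]
    by_cases ha : a ∈ K <;> by_cases hb : b ∈ K <;> by_cases hc : c ∈ K <;>
      simp [ha, hb, hc, two]

/-- A cut with connected sides is coarsely connected: however one splits it in two parts, some
generating cycle meets both. -/
theorem exists_edist_le_of_isSC {G : SimpleGraph V} {k : ℕ} (hG : IsSC G k) {K : Set V}
    (hK : ∀ w ∈ K, ∀ w' ∈ K, Joined G Kᶜ w w')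
    {U : Set V} (hU : U = {u | u ∉ K ∧ ∃ w ∈ K, G.Adj u w})
    (hU' : ∀ u ∈ U, ∀ u' ∈ U, Joined G K u u')
    (hfin : {e : G.edgeSet | IsCrossing K (fun _ => True) e}.Finite)
    (P : V → Prop) {u₁ u₂ : V} (h₁ : u₁ ∈ U) (hP₁ : P u₁) (h₂ : u₂ ∈ U) (hP₂ : ¬ P u₂) :
    ∃ v₁ ∈ U, P v₁ ∧ ∃ v₂ ∈ U, ¬ P v₂ ∧ G.edist v₁ v₂ ≤ k := by
  classical
  -- `F` is the whole cut and `F₁` its part with outer endpoint in `P`. If the two parts are more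
  -- than `k` apart, the parity of crossings of `F₁` vanishes on the cycle space, yet some cycle
  -- crosses `F₁` exactly once.
  by_contra! hcon
  set F := hfin.toFinset with hFdef
  have hF : ∀ e : G.edgeSet, e ∈ F ↔ IsCrossing K (fun _ => True) e := by simp [hFdef]
  set F₁ := F.filter fun e : G.edgeSet => IsCrossing K P e with hF₁def
  have hF₁ : ∀ e : G.edgeSet, e ∈ F₁ ↔ IsCrossing K P e := by
    intro e
    rw [hF₁def, Finset.mem_filter, hF, and_iff_right_iff_imp]
    rintro ⟨u, w, h, hu, hw, -⟩
    exact ⟨u, w, h, hu, hw, trivial⟩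
  obtain ⟨S, hS, hspan⟩ := hG
  have hzero : ∀ x ∈ cycleSpace G, sumOver F₁ x = 0 := by
    rw [← hspan]
    suffices h : Submodule.span (ZMod 2) S ≤ LinearMap.ker (sumOver F₁) from
      fun x hx => by simpa using h hx
    rw [Submodule.span_le]
    intro x hx
    obtain ⟨v, p, hp, hlen, rfl⟩ := hS x hx
    rw [SetLike.mem_coe, LinearMap.mem_ker, edgeVector_eq_walkVector hp.isTrail]
    by_cases hmeet : ∃ e : G.edgeSet, e ∈ F₁ ∧ (e : Sym2 V) ∈ p.edges
    · obtain ⟨⟨e₁, he₁'⟩, he₁, hep⟩ := hmeet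
      rw [hF₁] at he₁
      obtain ⟨v₁, w₁, rfl, hv₁, hw₁, hPv₁⟩ := he₁
      have hv₁U : v₁ ∈ U := by
        rw [hU]
        exact ⟨hv₁, w₁, hw₁, he₁'⟩
      have hv₁p : v₁ ∈ p.support := p.fst_mem_support_of_mem_edges hep
      -- A generating cycle through `F₁` is too short to reach the rest of the cut, so it meets `F₁`
      -- as often as `F`, which is an even number of times.
      have hall : sumOver F₁ (walkVector G p) = sumOver F (walkVector G p) := by
        rw [sumOver_apply, sumOver_apply]
        refine Finset.sum_subset (Finset.filter_subset _ _) fun e he he' => ?_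
        refine walkVector_apply_of_notMem p e fun hep' => ?_
        obtain ⟨e, hee⟩ := e
        rw [hF] at he
        rw [hF₁] at he'
        obtain ⟨v₂, w₂, rfl, hv₂, hw₂, -⟩ := he
        have hPv₂ : ¬ P v₂ := fun h => he' ⟨v₂, w₂, rfl, hv₂, hw₂, h⟩
        have hv₂p : v₂ ∈ p.support := p.fst_mem_support_of_mem_edges hep'
        refine (hcon v₁ hv₁U hPv₁ v₂ (by rw [hU]; exact ⟨hv₂, w₂, hw₂, hee⟩) hPv₂).not_ge ?_
        have h1 : v₂ ∈ (p.rotate v₁ hv₁p).support := by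
          rw [SimpleGraph.Walk.mem_support_rotate_iff]
          exact hv₂p
        refine (SimpleGraph.edist_le ((p.rotate v₁ hv₁p).takeUntil v₂ h1)).trans ?_
        have h2 := (p.rotate v₁ hv₁p).length_takeUntil_le_length h1
        rw [SimpleGraph.Walk.length_rotate] at h2
        exact_mod_cast h2.trans hlen
      rw [hall, sumOver_walkVector hF]
      exact CharTwo.add_self_eq_zero _
    · push Not at hmeet
      rw [sumOver_apply]
      exact Finset.sum_eq_zero fun e he => walkVector_apply_of_notMem p e (hmeet e he)
  have h₁' := h₁
  have h₂' := h₂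
  rw [hU] at h₁' h₂'
  obtain ⟨hu₁, w₁, hw₁, hadj₁⟩ := h₁'
  obtain ⟨hu₂, w₂, hw₂, hadj₂⟩ := h₂'
  obtain ⟨p₀, hp₀⟩ := hK w₁ hw₁ w₂ hw₂
  obtain ⟨q₀, hq₀⟩ := hU' u₂ h₂ u₁ h₁
  obtain ⟨p, hpp, hp⟩ : ∃ p : G.Walk w₁ w₂, p.IsPath ∧ ∀ x ∈ p.support, x ∈ K :=
    ⟨p₀.bypass, p₀.bypass_isPath, fun x hx => by
      simpa using hp₀ x (p₀.support_bypass_subset_support hx)⟩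
  obtain ⟨q, hqp, hq⟩ : ∃ q : G.Walk u₂ u₁, q.IsPath ∧ ∀ x ∈ q.support, x ∉ K :=
    ⟨q₀.bypass, q₀.bypass_isPath, fun x hx => hq₀ x (q₀.support_bypass_subset_support hx)⟩
  have hne : u₁ ≠ u₂ := fun h => hP₂ (h ▸ hP₁)
  -- The cycle runs from `u₁` into `K`, through `K` to `w₂`, out to `u₂`, and back outside `K`. It
  -- crosses the cut only at `u₁w₁` and `u₂w₂`, and only the first of these edges is in `F₁`.
  have hcyc : (SimpleGraph.Walk.cons hadj₁ (p.append (.cons hadj₂.symm q))).IsCycle := by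
    rw [SimpleGraph.Walk.cons_isCycle_iff]
    constructor
    · rw [SimpleGraph.Walk.isPath_def, SimpleGraph.Walk.support_append, List.nodup_append]
      simp only [SimpleGraph.Walk.support_cons, List.tail_cons]
      refine ⟨hpp.support_nodup, hqp.support_nodup, ?_⟩
      rintro x hx y hy rfl
      exact hq x hy (hp x hx)
    · rw [SimpleGraph.Walk.edges_append, SimpleGraph.Walk.edges_cons]
      simp only [List.mem_append, List.mem_cons, not_or]
      refine ⟨fun h => hu₁ (hp _ (p.fst_mem_support_of_mem_edges h)), fun h => ?_,
        fun h => hq _ (q.snd_mem_support_of_mem_edges h) hw₁⟩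
      rcases Sym2.eq_iff.1 h with ⟨h, -⟩ | ⟨h, -⟩
      · exact hu₁ (h ▸ hw₂)
      · exact hne h
  have hz := hzero _ (Submodule.subset_span ⟨_, _, hcyc, rfl⟩)
  rw [edgeVector_eq_walkVector hcyc.isTrail, walkVector, walkVector_append, walkVector,
    map_add, map_add, map_add, sumOver_single, sumOver_single] at hz
  simp only [hF₁, isCrossing_mk] at hz
  have hp0 : sumOver F₁ (walkVector G p) = 0 := by
    rw [sumOver_apply]
    refine Finset.sum_eq_zero fun e he => walkVector_apply_of_notMem p e fun hep => ?_
    obtain ⟨e, hee⟩ := e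
    rw [hF₁] at he
    obtain ⟨a, b, rfl, ha, hb, -⟩ := he
    exact ha (hp _ (p.fst_mem_support_of_mem_edges hep))
  have hq0 : sumOver F₁ (walkVector G q) = 0 := by
    rw [sumOver_apply]
    refine Finset.sum_eq_zero fun e he => walkVector_apply_of_notMem q e fun hep => ?_
    obtain ⟨e, hee⟩ := e
    rw [hF₁] at he
    obtain ⟨a, b, rfl, ha, hb, -⟩ := he
    exact hq _ (q.snd_mem_support_of_mem_edges hep) hb
  rw [hp0, hq0] at hz
  simp [hu₁, hw₁, hu₂, hw₂, hP₁, hP₂] at hz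

/-- In a finite set any bipartition of which contains a pair at distance at most `k`, any two
points have distance at most `k` times the size. -/
theorem edist_le_of_coarsely_connected {G : SimpleGraph V} {k : ℕ} {U : Set V} (hU : U.Finite)
    (h : ∀ (P : V → Prop) (u₁ u₂ : V), u₁ ∈ U → P u₁ → u₂ ∈ U → ¬ P u₂ →
      ∃ v₁ ∈ U, P v₁ ∧ ∃ v₂ ∈ U, ¬ P v₂ ∧ G.edist v₁ v₂ ≤ k)
    {u v : V} (hu : u ∈ U) (hv : v ∈ U) : G.edist u v ≤ (k * U.ncard : ℕ) := by
  by_contra hcon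
  set A : ℕ → Set V := fun j => {w ∈ U | G.edist u w ≤ (k * j : ℕ)} with hA
  have hfin : ∀ j, (A j).Finite := fun j => hU.subset fun w hw => hw.1
  -- As long as `v` is not reached, enlarging the radius by `k` picks up a new point of `U`; after
  -- `U.ncard` steps there would be too many.
  have key : ∀ j ≤ U.ncard, j + 1 ≤ (A j).ncard := by
    intro j
    induction j with
    | zero =>
      intro _
      rw [Nat.zero_add, Nat.one_le_iff_ne_zero, ne_eq, Set.ncard_eq_zero (hfin 0)]
      exact Set.Nonempty.ne_empty ⟨u, hu, by simp⟩
    | succ j ih =>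
      intro hj
      refine (Nat.succ_le_succ (ih (by omega))).trans (Set.ncard_lt_ncard ?_ (hfin _))
      obtain ⟨v₁, h₁, hP₁, v₂, h₂, hP₂, h₁₂⟩ := h (fun w => G.edist u w ≤ (k * j : ℕ)) u v hu
        (by simp) hv fun h => hcon (h.trans (by
          norm_cast
          exact Nat.mul_le_mul_left k (by omega)))
      refine (Set.ssubset_iff_of_subset ?_).2 ⟨v₂, ⟨h₂, ?_⟩, fun h => hP₂ h.2⟩
      · rintro w ⟨hw, hw'⟩
        refine ⟨hw, hw'.trans ?_⟩
        norm_cast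
        exact Nat.mul_le_mul_left k (by omega)
      · refine (G.edist_triangle (v := v₁)).trans ((add_le_add hP₁ h₁₂).trans ?_)
        norm_cast
  have h1 := key _ le_rfl
  have h2 := Set.ncard_le_ncard (s := A U.ncard) (fun w hw => hw.1) hU
  omega

/-! ### Small spheres separate. -/

theorem IsGeodesic.edist_mid_left {G : SimpleGraph V} {γ : ℕ → V} {M t : ℕ}
    (h : IsGeodesic G γ (2 * M)) (ht : t ≤ M) : G.edist (γ M) (γ t) = (M - t : ℕ) := by
  rw [SimpleGraph.edist_comm, h t M ht (by omega)]

theorem IsGeodesic.edist_mid_right {G : SimpleGraph V} {γ : ℕ → V} {M t : ℕ}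
    (h : IsGeodesic G γ (2 * M)) (ht : M ≤ t) (ht' : t ≤ 2 * M) :
    G.edist (γ M) (γ t) = (t - M : ℕ) := h M t ht ht'

/-- If the sphere of radius `n` is small, then the ball of radius `n` separates the two ends of
any long geodesic through its centre. -/
theorem not_joined_of_small_sphere {G : SimpleGraph V} {k : ℕ} (hG : IsSC G k)
    (hfin : ∀ v r, (closedBall G v r).Finite) {γ : ℕ → V} {M n : ℕ}
    (hγ : IsGeodesic G γ (2 * M)) (hn : n < M)
    (hsmall : k * {v | G.edist (γ M) v = n}.ncard < 2 * n) :
    ¬ Joined G (closedBall G (γ M) n) (γ 0) (γ (2 * M)) := by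
  intro hab
  set o := γ M with ho
  set B := closedBall G o n with hB
  set K := component G B (γ 0) with hK
  set U : Set V := {u | u ∉ K ∧ ∃ w ∈ K, G.Adj u w} with hU
  have hKB : ∀ w ∈ K, w ∉ B := fun w hw => Joined.right_notMem hw
  have hUB : ∀ u ∈ U, u ∈ B := by
    rintro u ⟨hu, w, hw, hadj⟩
    by_contra huB
    exact hu (Joined.trans hw (.of_adj hadj.symm (hKB w hw) huB))
  have hUS : U ⊆ {v | G.edist o v = n} := by
    intro u hu
    refine le_antisymm (mem_closedBall.1 (hUB u hu)) ?_
    obtain ⟨-, w, hw, hadj⟩ := hu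
    by_contra! hlt
    refine hKB w hw (mem_closedBall.2 ?_)
    have h1 : G.edist o w ≤ G.edist o u + 1 :=
      G.edist_triangle.trans (add_le_add le_rfl (SimpleGraph.edist_eq_one_iff_adj.2 hadj).le)
    exact h1.trans (Order.add_one_le_of_lt hlt)
  have hSfin : {v | G.edist o v = n}.Finite := (hfin o n).subset fun v hv => le_of_eq hv
  have hUfin : U.Finite := hSfin.subset hUS
  have hcross : {e : G.edgeSet | IsCrossing K (fun _ => True) e}.Finite := by
    refine (((hfin o n).prod (hfin o (n + 1))).image (fun p : V × V => s(p.1, p.2))).preimage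
      Subtype.val_injective.injOn |>.subset ?_
    rintro ⟨e, he⟩ ⟨u, w, rfl, hu, hw, -⟩
    have huU : u ∈ B := hUB u ⟨hu, w, hw, he⟩
    refine ⟨(u, w), ⟨huU, ?_⟩, rfl⟩
    exact closedBall_subset_closedBall huU
      (mem_closedBall.2 (SimpleGraph.edist_eq_one_iff_adj.2 he).le)
  have hnot : ∀ t, M - n ≤ t → t ≤ M + n → γ t ∉ K := by
    intro t h1 h2 h3
    refine hKB _ h3 (mem_closedBall.2 ?_)
    rcases le_total t M with h | h
    · rw [ho, hγ.edist_mid_left h]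
      norm_cast
      omega
    · rw [ho, hγ.edist_mid_right h (by omega)]
      norm_cast
      omega
  have ha : γ (M - n) ∈ U := by
    refine ⟨hnot _ le_rfl (by omega), γ (M - n - 1), ?_, ?_⟩
    · refine hγ.joined (Nat.zero_le _) (by omega) fun t _ ht => ?_
      rw [hB, mem_closedBall, ho, hγ.edist_mid_left (by omega)]
      norm_cast
      omega
    · have := hγ.adj (i := M - n - 1) (by omega)
      rw [show M - n - 1 + 1 = M - n by omega] at this
      exact this.symm
  have hb : γ (M + n) ∈ U := by
    refine ⟨hnot _ (by omega) le_rfl, γ (M + n + 1), ?_, hγ.adj (by omega)⟩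
    refine hab.trans (Joined.symm (hγ.joined (by omega) le_rfl fun t ht ht' => ?_))
    rw [hB, mem_closedBall, ho, hγ.edist_mid_right (by omega) (by omega)]
    norm_cast
    omega
  -- The set `K` is connected as a component. The points of `U` are joined outside `K` through the
  -- centre of the ball `B`, which is disjoint from `K`.
  have hle := edist_le_of_coarsely_connected (k := k) hUfin (fun P u₁ u₂ h₁ hP₁ h₂ hP₂ =>
    exists_edist_le_of_isSC hG (K := K)
      (fun w hw w' hw' => (Joined.trans (Joined.symm hw) hw').of_disjoint fun x hx h =>
        h (Joined.trans hw hx)) hU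
      (fun u hu u' hu' => (joined_of_mem_closedBall (hUB u hu) fun x hx hx' =>
        hKB x hx' hx).symm.trans
          (joined_of_mem_closedBall (hUB u' hu') fun x hx hx' => hKB x hx' hx))
      hcross P h₁ hP₁ h₂ hP₂) ha hb
  rw [hγ _ _ (by omega) (by omega)] at hle
  have h1 : M + n - (M - n) ≤ k * U.ncard := by exact_mod_cast hle
  have h2 := Nat.mul_le_mul_left k (Set.ncard_le_ncard hUS hSfin)
  omega

/-- Vertices far away from a ball lie in infinite components of its complement. -/
theorem exists_component_infinite {G : SimpleGraph V}
    (hfin : ∀ v r, (closedBall G v r).Finite) (o : V) (n : ℕ) :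
    ∃ N : ℕ, ∀ w, G.edist o w ≠ ⊤ → (N : ℕ∞) < G.edist o w →
      (component G (closedBall G o n) w).Infinite := by
  set B := closedBall G o n with hB
  -- All finite components that can be reached from the centre pass through one of the finitely many
  -- vertices at distance `n + 1`, so their union is finite and hence bounded.
  set F : Set V := ⋃ x ∈ {x ∈ closedBall G o (n + 1) | (component G B x).Finite},
    component G B x with hF
  have hFfin : F.Finite :=
    ((hfin o (n + 1)).subset fun x hx => hx.1).biUnion fun x hx => hx.2
  obtain ⟨N, hN⟩ := (hFfin.image fun w => (G.edist o w).toNat).bddAbove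
  refine ⟨max N n, fun w hw hlt hcomp => ?_⟩
  obtain ⟨L, hL⟩ := ENat.ne_top_iff_exists.1 hw
  have hlt' : max N n < L := by rw [← hL] at hlt; exact_mod_cast hlt
  obtain ⟨y, hy, hyw⟩ := exists_joined_near (r := n) (s := n + 1) hw (by omega)
    (by rw [← hL]; norm_cast; omega)
  have hwF : w ∈ F := by
    refine Set.mem_biUnion (x := y) ⟨hy.le, hcomp.subset fun z hz => ?_⟩ hyw
    exact hyw.symm.trans hz
  have := hN (Set.mem_image_of_mem _ hwF)
  simp only [← hL, ENat.toNat_natCast] at this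
  omega

theorem exists_centered_geodesic {G : SimpleGraph V} (hT : IsVertexTransitive G)
    (hinf : ∀ (o : V) (N : ℕ), ∃ v, G.edist o v ≠ ⊤ ∧ (N : ℕ∞) < G.edist o v) (o : V) (M : ℕ) :
    ∃ γ : ℕ → V, γ M = o ∧ IsGeodesic G γ (2 * M) := by
  obtain ⟨v, hv, hlt⟩ := hinf o (2 * M)
  obtain ⟨γ, L, rfl, rfl, hγ⟩ := exists_isGeodesic hv
  rw [hγ 0 L (by omega) le_rfl] at hlt
  have hL : 2 * M < L := by exact_mod_cast hlt
  obtain ⟨φ, hφ⟩ := hT (γ M) (γ 0)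
  refine ⟨fun i => φ (γ i), hφ, fun i j hij hj => ?_⟩
  rw [edist_iso]
  exact hγ i j hij (by omega)

theorem exists_two_infinite_components {G : SimpleGraph V} {k n : ℕ} (hG : IsSC G k)
    (hT : IsVertexTransitive G) (hfin : ∀ v r, (closedBall G v r).Finite)
    (hinf : ∀ (o : V) (N : ℕ), ∃ v, G.edist o v ≠ ⊤ ∧ (N : ℕ∞) < G.edist o v)
    (hsmall : ∀ o, k * {v | G.edist o v = n}.ncard < 2 * n) (x : V) :
    ∃ a b, G.edist x a ≠ ⊤ ∧ G.edist x b ≠ ⊤ ∧ ¬ Joined G (closedBall G x n) a b ∧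
      (component G (closedBall G x n) a).Infinite ∧
      (component G (closedBall G x n) b).Infinite := by
  obtain ⟨N, hN⟩ := exists_component_infinite hfin x n
  obtain ⟨γ, rfl, hγ⟩ := exists_centered_geodesic hT hinf x (n + N + 1)
  refine ⟨γ 0, γ (2 * (n + N + 1)), ?_, ?_,
    not_joined_of_small_sphere hG hfin hγ (by omega) (hsmall _), hN _ ?_ ?_, hN _ ?_ ?_⟩
  · rw [hγ.edist_mid_left (by omega)]; exact ENat.natCast_ne_top _
  · rw [hγ.edist_mid_right (by omega) le_rfl]; exact ENat.natCast_ne_top _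
  · rw [hγ.edist_mid_left (by omega)]; exact ENat.natCast_ne_top _
  · rw [hγ.edist_mid_left (by omega)]; norm_cast; omega
  · rw [hγ.edist_mid_right (by omega) le_rfl]; exact ENat.natCast_ne_top _
  · rw [hγ.edist_mid_right (by omega) le_rfl]; norm_cast; omega

/-! ### Three infinite components, or linear growth. -/

/-- The complement of the ball of radius `R` around `x` has three infinite components (within the
component of `x`). -/
def HasThree (G : SimpleGraph V) (x : V) (R : ℕ) : Prop :=
  ∃ u : Fin 3 → V, (∀ i, G.edist x (u i) ≠ ⊤) ∧
    (∀ i, (component G (closedBall G x R) (u i)).Infinite) ∧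
    ∀ i j, i ≠ j → ¬ Joined G (closedBall G x R) (u i) (u j)

theorem HasThree.map {G : SimpleGraph V} (φ : G ≃g G) {x : V} {R : ℕ} (h : HasThree G x R) :
    HasThree G (φ x) R := by
  obtain ⟨u, h1, h2, h3⟩ := h
  refine ⟨fun i => φ (u i), fun i => by rw [edist_iso]; exact h1 i, fun i => ?_,
    fun i j hij hJ => h3 i j hij ?_⟩
  · refine ((h2 i).image φ.injective.injOn).mono ?_
    rintro _ ⟨y, hy, rfl⟩
    exact Joined.map φ (fun z => (map_mem_closedBall φ).1) hy
  · have := Joined.map φ.symm (A' := closedBall G x R) (fun z hz => by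
      have := (map_mem_closedBall φ).2 hz
      simpa using this) hJ
    simpa using this

theorem ncard_closedBall {G : SimpleGraph V} (hT : IsVertexTransitive G) (v w : V) (r : ℕ) :
    (closedBall G v r).ncard = (closedBall G w r).ncard := by
  obtain ⟨φ, rfl⟩ := hT v w
  rw [← image_closedBall, Set.ncard_image_of_injective _ φ.injective]

theorem ncard_sphere {G : SimpleGraph V} (hT : IsVertexTransitive G) (v w : V) (r : ℕ∞) :
    {x | G.edist v x = r}.ncard = {x | G.edist w x = r}.ncard := by
  obtain ⟨φ, rfl⟩ := hT v w
  rw [← Set.ncard_image_of_injective {x | G.edist v x = r} φ.injective]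
  congr 1
  ext y
  constructor
  · rintro ⟨x, hx, rfl⟩
    exact (edist_iso φ v x).trans hx
  · intro hy
    refine ⟨φ.symm y, ?_, by simp⟩
    rw [Set.mem_ofPred_eq, ← edist_iso φ]
    simpa using hy

/-- Without a ball whose removal leaves three infinite components, every vertex is close to a
geodesic, and so the growth is linear. -/
theorem ncard_closedBall_le {G : SimpleGraph V} {k n : ℕ} (hG : IsSC G k)
    (hT : IsVertexTransitive G) (hfin : ∀ v r, (closedBall G v r).Finite)
    (hinf : ∀ (o : V) (N : ℕ), ∃ v, G.edist o v ≠ ⊤ ∧ (N : ℕ∞) < G.edist o v)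
    (hsmall : ∀ o, k * {v | G.edist o v = n}.ncard < 2 * n) (o : V) (r : ℕ)
    (hthree : ¬ HasThree G o (r + n)) :
    (closedBall G o r).ncard ≤ (2 * (r + n) + 1) * (closedBall G o n).ncard := by
  obtain ⟨N, hN⟩ := exists_component_infinite hfin o (r + n)
  set M := r + n + N + 1 with hM
  obtain ⟨γ, hγM, hγ⟩ := exists_centered_geodesic hT hinf o M
  have hclose : ∀ v ∈ closedBall G o r, ∃ i ≤ 2 * M, γ i ∈ closedBall G v n := by
    intro v hv
    by_contra! hfar
    have hBB : closedBall G v n ⊆ closedBall G o (r + n) := closedBall_subset_closedBall hv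
    have hab : Joined G (closedBall G v n) (γ 0) (γ (2 * M)) :=
      hγ.joined (Nat.zero_le _) le_rfl fun t _ ht => hfar t ht
    have hab' : ¬ Joined G (closedBall G o (r + n)) (γ 0) (γ (2 * M)) := fun h => by
      refine not_joined_of_small_sphere hG hfin hγ (show n < M by omega) (hsmall _) ?_
      rw [hγM]
      exact h.mono (closedBall_mono G o (by omega))
    -- The geodesic avoids the ball around `v`, so it lies in one component of the complement; of
    -- two distinct infinite components, at least one is another.
    obtain ⟨c, hcv, hc, hcinf⟩ : ∃ c, G.edist v c ≠ ⊤ ∧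
        ¬ Joined G (closedBall G v n) c (γ 0) ∧
        (component G (closedBall G v n) c).Infinite := by
      obtain ⟨c, d, hcv, hdv, hcd, hc, hd⟩ :=
        exists_two_infinite_components hG hT hfin hinf hsmall v
      by_cases h : Joined G (closedBall G v n) c (γ 0)
      · exact ⟨d, hdv, fun h' => hcd (h.trans h'.symm), hd⟩
      · exact ⟨c, hcv, h, hc⟩
    -- Going beyond distance `N` from `o` makes the component of `w` infinite also after the larger
    -- ball around `o` is removed.
    obtain ⟨w, hcw, hw⟩ := hcinf.exists_notMem_finite (hfin o N)
    rw [mem_closedBall, not_le] at hw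
    have how : G.edist o w ≠ ⊤ := by
      have h1 := ne_top_of_le_ne_top (ENat.natCast_ne_top _) (mem_closedBall.1 hv)
      have h2 := Joined.edist_ne_top hcw
      rw [SimpleGraph.edist_ne_top_iff_reachable] at *
      exact (h1.trans hcv).trans h2
    have hwa : ¬ Joined G (closedBall G o (r + n)) w (γ 0) := fun h =>
      hc (Joined.trans hcw (h.mono hBB))
    have hwb : ¬ Joined G (closedBall G o (r + n)) w (γ (2 * M)) := fun h =>
      hc ((Joined.trans hcw (h.mono hBB)).trans hab.symm)
    have hγ0 : G.edist o (γ 0) = M := by rw [← hγM, hγ.edist_mid_left (by omega)]; simp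
    have hγ1 : G.edist o (γ (2 * M)) = M := by
      rw [← hγM, hγ.edist_mid_right (by omega) le_rfl, two_mul]
      simp
    have hM0 : G.edist o (γ 0) ≠ ⊤ := by rw [hγ0]; exact ENat.natCast_ne_top _
    have hM1 : G.edist o (γ (2 * M)) ≠ ⊤ := by rw [hγ1]; exact ENat.natCast_ne_top _
    have hNM : (N : ℕ∞) < M := by norm_cast; omega
    refine hthree ⟨![γ 0, γ (2 * M), w], ?_, ?_, ?_⟩
    · intro i
      fin_cases i
      exacts [hM0, hM1, how]
    · intro i
      fin_cases i
      exacts [hN _ hM0 (hγ0 ▸ hNM), hN _ hM1 (hγ1 ▸ hNM), hN w how hw]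
    · intro i j hij
      fin_cases i <;> fin_cases j <;> first | exact absurd rfl hij | skip
      exacts [hab', fun h => hwa h.symm, fun h => hab' h.symm, fun h => hwb h.symm, hwa, hwb]
  -- A point of the geodesic within `n` of a vertex of this ball is within `r + n` of `o = γ M`, so
  -- at most `2 * (r + n) + 1` indices matter.
  have hsub : closedBall G o r ⊆
      ⋃ i ∈ Finset.Icc (M - (r + n)) (M + (r + n)), closedBall G (γ i) n := by
    intro v hv
    obtain ⟨i, hi, hiv⟩ := hclose v hv
    refine Set.mem_biUnion (x := i) ?_ (by
      rw [mem_closedBall, SimpleGraph.edist_comm]; exact hiv)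
    have h1 := mem_closedBall.1 (closedBall_subset_closedBall hv hiv)
    rw [← hγM] at h1
    rw [Finset.mem_coe, Finset.mem_Icc]
    rcases le_total i M with h | h
    · rw [hγ.edist_mid_left h] at h1
      have : M - i ≤ r + n := by exact_mod_cast h1
      omega
    · rw [hγ.edist_mid_right h hi] at h1
      have : i - M ≤ r + n := by exact_mod_cast h1
      omega
  refine (Set.ncard_le_ncard hsub
    ((Finset.finite_toSet _).biUnion fun i _ => hfin _ _)).trans ?_
  refine (Finset.set_ncard_biUnion_le _ _).trans ?_
  rw [Finset.sum_congr rfl fun i _ => ncard_closedBall hT (γ i) o n, Finset.sum_const, smul_eq_mul,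
    Nat.card_Icc]
  exact Nat.mul_le_mul_right _ (by omega)

/-- If the removal of any ball of radius `R` leaves three infinite components, then the growth is
exponential. -/
theorem two_pow_le_ncard {G : SimpleGraph V} (hfin : ∀ v r, (closedBall G v r).Finite) {R : ℕ}
    (hthree : ∀ x, HasThree G x R) (j : ℕ) (x u : V) (hu : G.edist x u ≠ ⊤)
    (huinf : (component G (closedBall G x R) u).Infinite) :
    2 ^ j ≤ (component G (closedBall G x R) u ∩
      closedBall G x ((2 * R + 1) * j + (R + 1))).ncard := by
  have hnear : ∀ x u, G.edist x u ≠ ⊤ → u ∉ closedBall G x R →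
      ∃ y, G.edist x y = (R + 1 : ℕ) ∧ Joined G (closedBall G x R) u y := by
    intro x u hu huR
    obtain ⟨y, hy, hyu⟩ := exists_joined_near (r := R) (s := R + 1) hu (by omega) (by
      rw [mem_closedBall, not_le] at huR
      push_cast
      exact Order.add_one_le_of_lt huR)
    exact ⟨y, hy, hyu.symm⟩
  induction j generalizing x u with
  | zero =>
    rw [pow_zero, Nat.one_le_iff_ne_zero, ne_eq, Set.ncard_eq_zero ((hfin _ _).inter_of_right _)]
    obtain ⟨w, hw⟩ := huinf.nonempty
    obtain ⟨y, hy, hyu⟩ := hnear x u hu (Joined.left_notMem hw)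
    refine Set.Nonempty.ne_empty ⟨y, hyu, ?_⟩
    rw [mem_closedBall, hy, mul_zero, zero_add]
  | succ j ih =>
    set K := component G (closedBall G x R) u with hK
    obtain ⟨w, hw, hwx⟩ := huinf.exists_notMem_finite (hfin x (2 * R + 1))
    rw [mem_closedBall, not_le] at hwx
    have hwtop : G.edist x w ≠ ⊤ := by
      have h2 := Joined.edist_ne_top hw
      rw [SimpleGraph.edist_ne_top_iff_reachable] at *
      exact hu.trans h2
    -- Distance `2 * R + 1` is the least that makes the triangle inequality force the `R`-balls
    -- around `x` and `y` to be disjoint.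
    obtain ⟨y, hxy, hyw⟩ := exists_joined_near (r := R) (s := 2 * R + 1) hwtop (by omega) hwx.le
    have hyK : y ∈ K := Joined.trans hw hyw.symm
    have hdisj : ∀ z ∈ closedBall G y R, z ∉ closedBall G x R := by
      intro z hzy hzx
      rw [mem_closedBall] at hzy hzx
      rw [SimpleGraph.edist_comm] at hzy
      have := G.edist_triangle.trans (add_le_add hzx hzy)
      rw [hxy] at this
      norm_cast at this
      omega
    obtain ⟨c, hcy, hcinf, hcc⟩ := hthree y
    -- A component beyond `y` that misses `x` misses the whole ball around `x`, as that ball is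
    -- connected in the complement of the ball around `y`. It is linked to `y` by a geodesic inside
    -- the ball around `y` up to its last vertex, so it lies in `K`.
    have hsub : ∀ i, ¬ Joined G (closedBall G y R) (c i) x →
        component G (closedBall G y R) (c i) ⊆ K := by
      intro i hi z hz
      have hav : ∀ q, Joined G (closedBall G y R) (c i) q → q ∉ closedBall G x R :=
        fun q hq hqx => hi (hq.trans
          (joined_of_mem_closedBall hqx fun t ht ht' => hdisj t ht' ht).symm)
      obtain ⟨q, hq, hcq⟩ := hnear y (c i) (hcy i) (Joined.left_notMem hz)
      have hyq : Joined G (closedBall G x R) y q := by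
        obtain ⟨γ, L, rfl, rfl, hγ⟩ := exists_isGeodesic (x := y) (w := q)
          (by rw [hq]; exact ENat.natCast_ne_top _)
        have hL : L = R + 1 := by
          rw [hγ 0 L (by omega) le_rfl] at hq
          have : L - 0 = R + 1 := by exact_mod_cast hq
          omega
        refine hγ.joined (by omega) le_rfl fun t _ ht => ?_
        rcases ht.lt_or_eq with ht | rfl
        · refine hdisj _ ?_
          rw [mem_closedBall, hγ 0 t (by omega) (by omega)]
          norm_cast
          omega
        · exact hav _ hcq
      exact (Joined.trans hyK hyq).trans
        ((Joined.trans hcq.symm hz).of_disjoint fun t ht => hav t (hcq.trans ht))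
    -- At most one of the three components contains `x`; the other two are the branches for the
    -- induction.
    obtain ⟨a, b, hab, ha, hb⟩ : ∃ a b, a ≠ b ∧ ¬ Joined G (closedBall G y R) (c a) x ∧
        ¬ Joined G (closedBall G y R) (c b) x := by
      by_contra! hcon
      by_cases h0 : Joined G (closedBall G y R) (c 0) x
      · by_cases h1 : Joined G (closedBall G y R) (c 1) x
        · exact hcc 0 1 (by decide) (h0.trans h1.symm)
        · exact hcc 0 2 (by decide) (h0.trans (hcon 1 2 (by decide) h1).symm)
      · exact hcc 1 2 (by decide)
          ((hcon 0 1 (by decide) h0).trans (hcon 0 2 (by decide) h0).symm)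
    have hball : closedBall G y ((2 * R + 1) * j + (R + 1)) ⊆
        closedBall G x ((2 * R + 1) * (j + 1) + (R + 1)) := by
      have h := closedBall_subset_closedBall (r := (2 * R + 1) * j + (R + 1))
        (mem_closedBall.2 hxy.le)
      rwa [show 2 * R + 1 + ((2 * R + 1) * j + (R + 1)) = (2 * R + 1) * (j + 1) + (R + 1) by
        ring] at h
    have hd : Disjoint
        (component G (closedBall G y R) (c a) ∩ closedBall G y ((2 * R + 1) * j + (R + 1)))
        (component G (closedBall G y R) (c b) ∩ closedBall G y ((2 * R + 1) * j + (R + 1))) :=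
      Set.disjoint_left.2 fun t h1 h2 => hcc a b hab (Joined.trans h1.1 (Joined.symm h2.1))
    calc 2 ^ (j + 1) = 2 ^ j + 2 ^ j := by ring
      _ ≤ _ := add_le_add (ih y (c a) (hcy a) (hcinf a)) (ih y (c b) (hcy b) (hcinf b))
      _ = _ := (Set.ncard_union_eq hd ((hfin _ _).inter_of_right _)
          ((hfin _ _).inter_of_right _)).symm
      _ ≤ _ := Set.ncard_le_ncard (Set.union_subset
          (Set.inter_subset_inter (hsub a ha) hball)
          (Set.inter_subset_inter (hsub b hb) hball)) ((hfin _ _).inter_of_right _)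

/-! ### Growth estimates and the theorem for vertex-transitive graphs. -/

theorem finite_closedBall {G : SimpleGraph V} (h : ∀ v, (closedBall G v 1).Finite) (v : V) (r : ℕ) :
    (closedBall G v r).Finite := by
  induction r with
  | zero =>
    refine (Set.finite_singleton v).subset fun w hw => ?_
    rw [mem_closedBall, Nat.cast_zero, nonpos_iff_eq_zero, SimpleGraph.edist_eq_zero_iff] at hw
    exact hw.symm
  | succ r ih =>
    refine (ih.biUnion fun w _ => h w).subset fun w hw => ?_
    by_cases hr : w ∈ closedBall G v r
    · exact Set.mem_biUnion hr (mem_closedBall_self G w 1)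
    rw [mem_closedBall] at hw
    obtain ⟨γ, L, rfl, rfl, hγ⟩ := exists_isGeodesic (ne_top_of_le_ne_top (ENat.natCast_ne_top _) hw)
    rw [hγ 0 L (by omega) le_rfl] at hw
    rw [mem_closedBall, hγ 0 L (by omega) le_rfl] at hr
    norm_cast at hw hr
    refine Set.mem_biUnion (x := γ (L - 1)) ?_ ?_
    · rw [mem_closedBall, hγ 0 (L - 1) (by omega) (by omega)]
      norm_cast
      omega
    · rw [mem_closedBall, hγ (L - 1) L (by omega) (by omega)]
      norm_cast
      omega

theorem succ_sq_le_two_pow (j : ℕ) : (j + 1) ^ 2 ≤ 4 * 2 ^ j := by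
  induction j with
  | zero => norm_num
  | succ j ih =>
    rcases Nat.lt_or_ge j 2 with h | h
    · interval_cases j <;> norm_num
    · rw [pow_succ 2 j]
      nlinarith

/-- Subquadratic growth forces a sphere that is small compared with its radius. -/
theorem exists_small_sphere {G : SimpleGraph V} (hfin : ∀ v r, (closedBall G v r).Finite) (v : V)
    (hsub : IsSubquadratic (growth G v)) (k : ℕ) :
    ∃ n : ℕ, k * {x | G.edist v x = n}.ncard < 2 * n := by
  by_contra! h
  -- Passing from `r` to `r + 1` adds at least `2 * (r + 1)` on the right and only `2 * r + 1` on
  -- the left.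
  have key : ∀ r : ℕ, r ^ 2 ≤ k * (closedBall G v r).ncard := by
    intro r
    induction r with
    | zero => simp
    | succ r ih =>
      have hd : Disjoint (closedBall G v r) {x | G.edist v x = (r + 1 : ℕ)} := by
        refine Set.disjoint_left.2 fun x hx hx' => ?_
        rw [mem_closedBall, hx'] at hx
        norm_cast at hx
        omega
      have hle : (closedBall G v r).ncard + {x | G.edist v x = (r + 1 : ℕ)}.ncard ≤
          (closedBall G v (r + 1)).ncard := by
        rw [← Set.ncard_union_eq hd (hfin v r) ((hfin v (r + 1)).subset fun x hx => le_of_eq hx)]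
        exact Set.ncard_le_ncard (Set.union_subset (closedBall_mono G v (by omega))
          fun x hx => le_of_eq hx) (hfin v (r + 1))
      have := Nat.mul_le_mul_left k hle
      have := h (r + 1)
      nlinarith
  obtain ⟨r, -, hr⟩ := hsub k
  rw [growth, ← (hfin v r).cast_ncard_eq] at hr
  norm_cast at hr
  exact absurd (key r) (by omega)

theorem not_superlinear_and_subquadratic {G : SimpleGraph V} {k : ℕ} (hG : IsSC G k)
    (hT : IsVertexTransitive G) (v : V) :
    ¬ (IsSuperlinear (growth G v) ∧ IsSubquadratic (growth G v)) := by
  rintro ⟨hsup, hsub⟩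
  have hfin : ∀ v r, (closedBall G v r).Finite := by
    obtain ⟨r, hr1, hr⟩ := hsub 1
    have hvr : (closedBall G v r).Finite := by
      rw [← Set.encard_ne_top_iff]
      rintro h
      rw [growth, h, Nat.cast_one, one_mul] at hr
      exact absurd hr (by simp)
    have hv : (closedBall G v 1).Finite := hvr.subset (closedBall_mono G v hr1)
    refine finite_closedBall fun w => ?_
    obtain ⟨φ, rfl⟩ := hT v w
    rw [← image_closedBall]
    exact hv.image φ
  have hgrowth : ∀ r, growth G v r = ((closedBall G v r).ncard : ℕ∞) := fun r =>
    ((hfin v r).cast_ncard_eq).symm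
  have hinfv : ∀ N : ℕ, ∃ w, G.edist v w ≠ ⊤ ∧ (N : ℕ∞) < G.edist v w := by
    intro N
    by_contra! hcon
    obtain ⟨r, hr1, hr⟩ := hsup (closedBall G v N).ncard
    rw [hgrowth] at hr
    have hle : (closedBall G v r).ncard ≤ (closedBall G v N).ncard :=
      Set.ncard_le_ncard (fun w hw => hcon w
        (ne_top_of_le_ne_top (ENat.natCast_ne_top _) (mem_closedBall.1 hw))) (hfin v N)
    norm_cast at hr
    nlinarith
  have hinf : ∀ (o : V) (N : ℕ), ∃ w, G.edist o w ≠ ⊤ ∧ (N : ℕ∞) < G.edist o w := by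
    intro o N
    obtain ⟨φ, rfl⟩ := hT v o
    obtain ⟨w, hw⟩ := hinfv N
    exact ⟨φ w, by rwa [edist_iso]⟩
  obtain ⟨n, hn⟩ := exists_small_sphere hfin v hsub k
  have hsmall : ∀ o, k * {x | G.edist o x = n}.ncard < 2 * n := fun o => by
    rwa [ncard_sphere hT o v n]
  by_cases hthree : ∃ R, HasThree G v R
  · obtain ⟨R, hR⟩ := hthree
    have hall : ∀ x, HasThree G x R := fun x => by
      obtain ⟨φ, rfl⟩ := hT v x
      exact hR.map φ
    -- For `j ≥ 1` the radius `(2 * R + 1) * j + (R + 1)` is at most `(3 * R + 2) * j`.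
    have hexp : ∀ j, 2 ^ j ≤ (closedBall G v ((3 * R + 2) * j)).ncard := by
      intro j
      obtain rfl | hj := Nat.eq_zero_or_pos j
      · rw [pow_zero, Nat.one_le_iff_ne_zero, ne_eq, Set.ncard_eq_zero (hfin _ _)]
        exact Set.Nonempty.ne_empty ⟨v, mem_closedBall_self G v _⟩
      · obtain ⟨c, hc, hcinf, -⟩ := hR
        refine (two_pow_le_ncard hfin hall j v (c 0) (hc 0) (hcinf 0)).trans
          (Set.ncard_le_ncard (Set.inter_subset_right.trans (closedBall_mono G v ?_)) (hfin _ _))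
        nlinarith
    -- With `j = r / (3 * R + 2)`, the bound `(j + 1) ^ 2 ≤ 4 * 2 ^ j` turns exponential growth into
    -- `r ^ 2 ≤ 4 * (3 * R + 2) ^ 2 * |B_r|`.
    obtain ⟨r, -, hr⟩ := hsub (4 * (3 * R + 2) ^ 2)
    rw [hgrowth] at hr
    norm_cast at hr
    have hj := Nat.div_add_mod r (3 * R + 2)
    have hmod := Nat.mod_lt r (show 3 * R + 2 > 0 by omega)
    set j := r / (3 * R + 2)
    have h1 : (closedBall G v ((3 * R + 2) * j)).ncard ≤ (closedBall G v r).ncard :=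
      Set.ncard_le_ncard (closedBall_mono G v (by omega)) (hfin _ _)
    have h2 : r ≤ (3 * R + 2) * (j + 1) := by nlinarith
    have h3 : r ^ 2 ≤ (3 * R + 2) ^ 2 * (j + 1) ^ 2 := by
      rw [← mul_pow]
      exact Nat.pow_le_pow_left h2 2
    have h4 := Nat.mul_le_mul_left ((3 * R + 2) ^ 2)
      ((succ_sq_le_two_pow j).trans (Nat.mul_le_mul_left 4 ((hexp j).trans h1)))
    have h5 := h3.trans h4
    rw [← mul_assoc, mul_comm _ 4] at h5
    omega
  · push Not at hthree
    obtain ⟨r, hr1, hr⟩ := hsup ((2 * n + 3) * (closedBall G v n).ncard)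
    rw [hgrowth] at hr
    norm_cast at hr
    have h1 := ncard_closedBall_le hG hT hfin hinf hsmall v r (hthree _)
    have h2 : (2 * (r + n) + 1) ≤ (2 * n + 3) * r := by nlinarith
    have h3 := Nat.mul_le_mul_right (closedBall G v n).ncard h2
    rw [mul_right_comm] at h3
    omega

/-! ### Closed walks modulo short cycles. -/

/-- The subspace of the edge space generated by the cycles of length at most `k`. -/
noncomputable def shortCycleSpace (G : SimpleGraph V) (k : ℕ) :
    Submodule (ZMod 2) (G.edgeSet → ZMod 2) :=
  Submodule.span (ZMod 2)
    {x | ∃ (v : V) (p : G.Walk v v), p.IsCycle ∧ p.length ≤ k ∧ x = edgeVector G p}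

/-- An edge closing up a path either gives a cycle or retraces the only edge of the path; in the
latter case the two contributions cancel modulo 2. -/
theorem walkVector_cons_mem_shortCycleSpace {G : SimpleGraph V} {k : ℕ} {u v : V}
    (h : G.Adj u v) {t : G.Walk v u} (ht : t.IsPath) (hk : t.length + 1 ≤ k) :
    walkVector G (.cons h t) ∈ shortCycleSpace G k := by
  classical
  by_cases he : s(u, v) ∈ t.edges
  · cases t with
    | nil => exact absurd h G.irrefl
    | @cons _ x _ h' t =>
      rw [SimpleGraph.Walk.cons_isPath_iff] at ht
      rw [SimpleGraph.Walk.edges_cons, List.mem_cons] at he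
      rcases he with he | he
      · obtain rfl : u = x := by
          rcases Sym2.eq_iff.1 he with ⟨rfl, rfl⟩ | ⟨rfl, -⟩
          · exact absurd h G.irrefl
          · rfl
        obtain rfl : t = .nil := (SimpleGraph.Walk.isPath_iff_nil.1 ht.1).eq_nil
        have hee : (⟨s(v, u), G.mem_edgeSet.2 h'⟩ : G.edgeSet) = ⟨s(u, v), G.mem_edgeSet.2 h⟩ :=
          Subtype.ext Sym2.eq_swap
        rw [walkVector, walkVector, walkVector, hee, add_zero, ZModModule.add_self]
        exact Submodule.zero_mem _
      · exact absurd (t.snd_mem_support_of_mem_edges he) ht.2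
  · have hc := (SimpleGraph.Walk.cons_isCycle_iff t h).2 ⟨ht, he⟩
    rw [← edgeVector_eq_walkVector hc.isTrail]
    exact Submodule.subset_span ⟨u, _, hc, by simpa using hk, rfl⟩

/-- Up to short cycles, a short walk is a path. -/
theorem exists_isPath_walkVector_sub_mem {G : SimpleGraph V} {k : ℕ} {u v : V} (p : G.Walk u v)
    (hp : p.length ≤ k) : ∃ q : G.Walk u v, q.IsPath ∧ q.length ≤ p.length ∧
      walkVector G p - walkVector G q ∈ shortCycleSpace G k := by
  classical
  induction p with
  | nil => exact ⟨.nil, by simp, le_rfl, by simp⟩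
  | @cons u v w h p ih =>
    rw [SimpleGraph.Walk.length_cons] at hp ⊢
    obtain ⟨q, hq, hqp, hmem⟩ := ih (by omega)
    by_cases hu : u ∈ q.support
    · refine ⟨q.dropUntil u hu, hq.dropUntil hu, ?_, ?_⟩
      · have := q.length_dropUntil_le_length hu
        omega
      · have h1 := walkVector_cons_mem_shortCycleSpace (k := k) h (hq.takeUntil hu) (by
          have := q.length_takeUntil_le_length hu
          omega)
        have h2 : walkVector G q =
            walkVector G (q.takeUntil u hu) + walkVector G (q.dropUntil u hu) := by
          rw [← walkVector_append, SimpleGraph.Walk.take_spec]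
        have := add_mem hmem h1
        rw [h2, walkVector] at this
        rw [walkVector]
        convert this using 1
        abel
    · refine ⟨.cons h q, by rw [SimpleGraph.Walk.cons_isPath_iff]; exact ⟨hq, hu⟩,
        by simpa using hqp, ?_⟩
      rw [walkVector, walkVector, add_sub_add_left_eq_sub]
      exact hmem

theorem walkVector_mem_shortCycleSpace {G : SimpleGraph V} {k : ℕ} {u : V} (p : G.Walk u u)
    (hp : p.length ≤ k) : walkVector G p ∈ shortCycleSpace G k := by
  obtain ⟨q, hq, -, hmem⟩ := exists_isPath_walkVector_sub_mem p hp
  obtain rfl : q = .nil := (SimpleGraph.Walk.isPath_iff_nil.1 hq).eq_nil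
  simpa [walkVector] using hmem

theorem isSC_of_walkVector_mem {G : SimpleGraph V} {k : ℕ}
    (h : ∀ (u : V) (p : G.Walk u u), walkVector G p ∈ shortCycleSpace G k) : IsSC G k := by
  refine ⟨_, fun x hx => hx, le_antisymm (Submodule.span_mono ?_) (Submodule.span_le.2 ?_)⟩
  · rintro x ⟨v, p, hp, -, rfl⟩
    exact ⟨v, p, hp, rfl⟩
  · rintro x ⟨v, p, hp, rfl⟩
    rw [edgeVector_eq_walkVector hp.isTrail]
    exact h v p

open Classical in
/-- The vector of the edge `ab` if `a` and `b` are adjacent, and zero otherwise. -/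
noncomputable def stepVector (G : SimpleGraph V) (a b : V) : G.edgeSet → ZMod 2 :=
  if h : G.Adj a b then Pi.single ⟨s(a, b), G.mem_edgeSet.2 h⟩ 1 else 0

theorem stepVector_of_adj {G : SimpleGraph V} {a b : V} (h : G.Adj a b) :
    stepVector G a b = walkVector G h.toWalk := by
  classical
  simp [stepVector, h, walkVector]

theorem stepVector_comm (G : SimpleGraph V) (a b : V) : stepVector G a b = stepVector G b a := by
  classical
  by_cases h : G.Adj a b
  · rw [stepVector, stepVector, dif_pos h, dif_pos h.symm]
    congr 1
    exact Subtype.ext Sym2.eq_swap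
  · rw [stepVector, stepVector, dif_neg h, dif_neg (fun h' => h h'.symm)]

/-- The case `a = b` arises from a generator equal to `1`: the graph has no loops, and the default
value zero matches the empty walk. -/
theorem exists_walk_stepVector {G : SimpleGraph V} {a b : V} (h : a ≠ b → G.Adj a b) :
    ∃ p : G.Walk a b, p.length ≤ 1 ∧ stepVector G a b = walkVector G p := by
  by_cases hab : a = b
  · subst hab
    exact ⟨.nil, by simp, by simp [stepVector, walkVector]⟩
  · exact ⟨(h hab).toWalk, by simp, stepVector_of_adj (h hab)⟩

/-! ### Cayley graphs of finitely presented groups. -/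

section Cayley

variable {Γ : Type u} [Group Γ] (S : Set Γ)

theorem isVertexTransitive_mulCayley : IsVertexTransitive (SimpleGraph.mulCayley S) := fun v w =>
  ⟨⟨Equiv.mulLeft (w * v⁻¹), by
    intro a b
    exact SimpleGraph.mulCayley_adj_mul_iff_right⟩, by simp⟩

variable (W : Submodule (ZMod 2) ((SimpleGraph.mulCayley S).edgeSet → ZMod 2))

/-- The generator `s` moves the vertex `g⁻¹` to `g⁻¹ s⁻¹` and records the traversed edge modulo
`W`. -/
noncomputable def stepPerm (s : S) :
    Equiv.Perm (Γ × (((SimpleGraph.mulCayley S).edgeSet → ZMod 2) ⧸ W)) where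
  -- Edges of `mulCayley` come from right multiplication, while permutations compose as a left
  -- action; inverting the vertex reconciles the two.
  toFun z := (s * z.1, z.2 + W.mkQ (stepVector (SimpleGraph.mulCayley S) z.1⁻¹ (s * z.1)⁻¹))
  invFun z := ((s : Γ)⁻¹ * z.1,
    z.2 - W.mkQ (stepVector (SimpleGraph.mulCayley S) ((s : Γ)⁻¹ * z.1)⁻¹ z.1⁻¹))
  left_inv z := by simp
  right_inv z := by simp

/-- The action of the free group by walks in the Cayley graph. -/
noncomputable def walkAction :
    FreeGroup S →* Equiv.Perm (Γ × (((SimpleGraph.mulCayley S).edgeSet → ZMod 2) ⧸ W)) :=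
  FreeGroup.lift (stepPerm S W)

/-- An element of the free group acts as a walk whose length is bounded in terms of the element. -/
theorem exists_walkAction_eq (w : FreeGroup S) :
    ∃ n : ℕ, ∀ (W : Submodule (ZMod 2) ((SimpleGraph.mulCayley S).edgeSet → ZMod 2)) (g : Γ),
      ∃ p : (SimpleGraph.mulCayley S).Walk g⁻¹ (FreeGroup.lift ((↑) : S → Γ) w * g)⁻¹,
        p.length ≤ n ∧ ∀ m, walkAction S W w (g, m) =
          (FreeGroup.lift ((↑) : S → Γ) w * g, m + W.mkQ (walkVector _ p)) := by
  induction w using FreeGroup.induction_on with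
  | C1 =>
    refine ⟨0, fun W g => ?_⟩
    rw [map_one, one_mul]
    exact ⟨.nil, le_rfl, fun m => by simp [walkVector]⟩
  | of s =>
    refine ⟨1, fun W g => ?_⟩
    obtain ⟨p, hp, hv⟩ := exists_walk_stepVector (G := SimpleGraph.mulCayley S) (a := g⁻¹)
      (b := (s * g : Γ)⁻¹) fun h => (SimpleGraph.mulCayley_adj _ _ _).2 ⟨h, .inr (by simp)⟩
    rw [FreeGroup.lift_apply_of]
    refine ⟨p, hp, fun m => ?_⟩
    rw [walkAction, FreeGroup.lift_apply_of, ← hv]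
    rfl
  | inv_of s _ =>
    refine ⟨1, fun W g => ?_⟩
    obtain ⟨p, hp, hv⟩ := exists_walk_stepVector (G := SimpleGraph.mulCayley S) (a := g⁻¹)
      (b := ((s : Γ)⁻¹ * g)⁻¹) fun h => (SimpleGraph.mulCayley_adj _ _ _).2 ⟨h, .inl (by simp)⟩
    rw [map_inv, FreeGroup.lift_apply_of]
    refine ⟨p, hp, fun m => ?_⟩
    -- The inverse permutation subtracts the vector of the same unoriented edge, and signs do not
    -- matter modulo 2.
    rw [map_inv, walkAction, FreeGroup.lift_apply_of, ← hv, stepVector_comm,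
      ← ZModModule.sub_eq_add]
    rfl
  | mul w₁ w₂ ih₁ ih₂ =>
    obtain ⟨n₁, h₁⟩ := ih₁
    obtain ⟨n₂, h₂⟩ := ih₂
    refine ⟨n₁ + n₂, fun W g => ?_⟩
    obtain ⟨p₂, hp₂, hv₂⟩ := h₂ W g
    obtain ⟨p₁, hp₁, hv₁⟩ := h₁ W (FreeGroup.lift ((↑) : S → Γ) w₂ * g)
    rw [map_mul, mul_assoc]
    refine ⟨p₂.append p₁, by rw [SimpleGraph.Walk.length_append]; omega, fun m => ?_⟩
    rw [map_mul, Equiv.Perm.mul_apply, hv₂, hv₁, walkVector_append, map_add, add_assoc]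

/-- Reading off the generators along a walk gives a word that acts by this walk. A closed walk gives
a relation. -/
theorem exists_walkAction_of_walk {a b : Γ} (p : (SimpleGraph.mulCayley S).Walk a b) :
    ∃ w : FreeGroup S, FreeGroup.lift ((↑) : S → Γ) w * a⁻¹ = b⁻¹ ∧
      ∀ m, walkAction S W w (a⁻¹, m) = (b⁻¹, m + W.mkQ (walkVector _ p)) := by
  induction p with
  | nil => exact ⟨1, by simp, fun m => by simp [walkVector]⟩
  | @cons a b c h p ih =>
    obtain ⟨w, hw, hwm⟩ := ih
    obtain ⟨t, ht, htm⟩ : ∃ t : FreeGroup S, FreeGroup.lift ((↑) : S → Γ) t * a⁻¹ = b⁻¹ ∧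
        ∀ m, walkAction S W t (a⁻¹, m) =
          (b⁻¹, m + W.mkQ (walkVector _ h.toWalk)) := by
      rcases ((SimpleGraph.mulCayley_adj _ _ _).1 h).2 with hs | hs
      · have hb : ((⟨a⁻¹ * b, hs⟩ : S) : Γ)⁻¹ * a⁻¹ = b⁻¹ := by simp
        refine ⟨(.of ⟨a⁻¹ * b, hs⟩)⁻¹, by rw [map_inv, FreeGroup.lift_apply_of, hb], fun m => ?_⟩
        rw [map_inv, walkAction, FreeGroup.lift_apply_of, ← stepVector_of_adj, stepVector_comm,
          ← ZModModule.sub_eq_add]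
        refine Prod.ext hb ?_
        change m - W.mkQ (stepVector _ (_ * a⁻¹)⁻¹ a⁻¹⁻¹) = _
        rw [hb, inv_inv, inv_inv]
      · have hb : ((⟨b⁻¹ * a, hs⟩ : S) : Γ) * a⁻¹ = b⁻¹ := by simp
        refine ⟨.of ⟨b⁻¹ * a, hs⟩, by rw [FreeGroup.lift_apply_of, hb], fun m => ?_⟩
        rw [walkAction, FreeGroup.lift_apply_of, ← stepVector_of_adj]
        refine Prod.ext hb ?_
        change m + W.mkQ (stepVector _ a⁻¹⁻¹ (_ * a⁻¹)⁻¹) = _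
        rw [hb, inv_inv, inv_inv]
    refine ⟨w * t, by rw [map_mul, mul_assoc, ht, hw], fun m => ?_⟩
    rw [map_mul, Equiv.Perm.mul_apply, htm, hwm, add_assoc, ← map_add, ← walkVector_append]
    rfl

/-- If the relations among the generators are normally generated by finitely many of them, then
the Cayley graph is `k`-simply-connected for some `k`. -/
theorem exists_isSC_mulCayley
    (hS : (FreeGroup.lift ((↑) : S → Γ)).ker.IsFinitelyNormallyGenerated) :
    ∃ k, IsSC (SimpleGraph.mulCayley S) k := by
  obtain ⟨R, hR, hker⟩ := hS
  choose n hn using exists_walkAction_eq S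
  -- The length bound `n` holds for all `W`, so `k` can be fixed before the subspace `W` that
  -- depends on it. Relators then act as closed walks of length at most `k`, hence trivially modulo
  -- `W`.
  obtain ⟨k, hk⟩ := (hR.image n).bddAbove
  refine ⟨k, isSC_of_walkVector_mem fun a p => ?_⟩
  set W := shortCycleSpace (SimpleGraph.mulCayley S) k
  have hle : Subgroup.normalClosure R ≤ (walkAction S W).ker := by
    refine Subgroup.normalClosure_le_normal fun r hr => ?_
    have hr1 : FreeGroup.lift ((↑) : S → Γ) r = 1 := by
      rw [← MonoidHom.mem_ker, ← hker]
      exact Subgroup.subset_normalClosure hr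
    refine Equiv.ext fun ⟨g, m⟩ => ?_
    have hex := hn r W g
    rw [hr1, one_mul] at hex
    obtain ⟨q, hq, hqm⟩ := hex
    have hmem : W.mkQ (walkVector _ q) = 0 :=
      (Submodule.Quotient.mk_eq_zero W).2
        (walkVector_mem_shortCycleSpace q (hq.trans (hk (Set.mem_image_of_mem n hr))))
    rw [hqm, hmem, add_zero]
    rfl
  obtain ⟨w, hw, hwm⟩ := exists_walkAction_of_walk S W p
  have hw1 : w ∈ (walkAction S W).ker := by
    refine hle ?_
    rw [hker, MonoidHom.mem_ker]
    simpa using hw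
  have h0 := hwm 0
  rw [MonoidHom.mem_ker.1 hw1, zero_add] at h0
  have h1 := (congrArg Prod.snd h0).symm
  exact (Submodule.Quotient.mk_eq_zero W).1 h1

end Cayley

/-- Rewriting between two generating systems: `θ` and `η` translate words each way. The set `T`
contains the translated relators together with relations saying that translating a letter there and
back changes nothing. Modulo `T`, any `x` equals `θ (η x)`, and if `f x = 1` then `η x` is a
consequence of `R`. -/
theorem ker_isFinitelyNormallyGenerated {Γ α : Type*} [Group Γ] [Finite α]
    (hΓ : Group.IsFinitelyPresented Γ) (f : FreeGroup α →* Γ) (hf : Function.Surjective f) :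
    f.ker.IsFinitelyNormallyGenerated := by
  obtain ⟨n, φ, hφ, R, hR, hker⟩ := hΓ.out
  choose w hw using fun i : Fin n => hf (φ (.of i))
  choose v hv using fun a : α => hφ (f (.of a))
  set θ := FreeGroup.lift w
  set η := FreeGroup.lift v
  have hθ : f.comp θ = φ := FreeGroup.ext_hom _ _ fun i => by simp [θ, hw]
  have hη : φ.comp η = f := FreeGroup.ext_hom _ _ fun a => by simp [η, hv]
  set T : Set (FreeGroup α) := θ '' R ∪ Set.range fun a => (.of a)⁻¹ * θ (v a) with hT
  have hcompat : (QuotientGroup.mk' (Subgroup.normalClosure T)).comp (θ.comp η) =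
      QuotientGroup.mk' (Subgroup.normalClosure T) := by
    refine FreeGroup.ext_hom _ _ fun a => Eq.symm ?_
    simp only [η, MonoidHom.comp_apply, FreeGroup.lift_apply_of, QuotientGroup.mk'_apply]
    exact QuotientGroup.eq.2 (Subgroup.subset_normalClosure (.inr ⟨a, rfl⟩))
  refine ⟨T, (hR.image _).union (Set.finite_range _), le_antisymm ?_ fun x hx => ?_⟩
  · refine Subgroup.normalClosure_le_normal ?_
    rintro _ (⟨r, hr, rfl⟩ | ⟨a, rfl⟩)
    · have : r ∈ φ.ker := hker ▸ Subgroup.subset_normalClosure hr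
      rw [SetLike.mem_coe, MonoidHom.mem_ker, ← MonoidHom.comp_apply, hθ]
      exact this
    · rw [SetLike.mem_coe, MonoidHom.mem_ker, map_mul, ← MonoidHom.comp_apply f θ, hθ, hv]
      simp
  · have h1 : η x ∈ Subgroup.normalClosure R := by
      rw [hker, MonoidHom.mem_ker, ← MonoidHom.comp_apply, hη]
      exact hx
    have h2 : Subgroup.normalClosure R ≤ (Subgroup.normalClosure T).comap θ :=
      Subgroup.normalClosure_le_normal fun r hr =>
        Subgroup.subset_normalClosure (.inl ⟨r, hr, rfl⟩)
    have h3 := DFunLike.congr_fun hcompat x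
    rw [← QuotientGroup.eq_one_iff]
    refine h3.symm.trans ?_
    exact (QuotientGroup.eq_one_iff _).2 (h2 h1)

end GraphGrowth

theorem mainTheorem6 :
    (∀ (k : ℕ) (V : Type*) (G : SimpleGraph V),
      GraphGrowth.IsSC G k → GraphGrowth.IsVertexTransitive G → ∀ v : V,
        ¬ (GraphGrowth.IsSuperlinear (GraphGrowth.growth G v) ∧
            GraphGrowth.IsSubquadratic (GraphGrowth.growth G v))) ∧
    (∀ (Γ : Type*) [Group Γ], Group.IsFinitelyPresented Γ →
      ∀ S : Set Γ, S.Finite → Subgroup.closure S = ⊤ →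
        ¬ (GraphGrowth.IsSuperlinear (GraphGrowth.growth (SimpleGraph.mulCayley S) 1) ∧
            GraphGrowth.IsSubquadratic (GraphGrowth.growth (SimpleGraph.mulCayley S) 1))) := by
  refine ⟨fun k V G hG hT v => GraphGrowth.not_superlinear_and_subquadratic hG hT v,
    fun Γ _ hΓ S hS hgen => ?_⟩
  have hfin : Finite S := hS
  have hsurj : Function.Surjective (FreeGroup.lift ((↑) : S → Γ)) := by
    rw [← MonoidHom.range_eq_top, FreeGroup.range_lift_eq_closure, Subtype.range_coe, hgen]
  obtain ⟨k, hk⟩ := GraphGrowth.exists_isSC_mulCayley S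
    (GraphGrowth.ker_isFinitelyNormallyGenerated hΓ _ hsurj)
  exact GraphGrowth.not_superlinear_and_subquadratic hk
    (GraphGrowth.isVertexTransitive_mulCayley S) 1
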